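/- Let $n,\ell\ge 0$ be integers. A topological toric manifold of dimension $2n$ is a closed (compact, Hausdorff, without boundary) smooth manifold $X$ of dimension $2n$ with an effective smooth action of $(\mathbb{C}^*)^n$ that has an open dense orbit, such that every point of $X$ lies in an invariant open subset which is equivariantly diffeomorphic to a direct sum $V(\chi_1)\oplus\dots\oplus V(\chi_n)$ of complex one-dimensional smooth representation spaces of $(\mathbb{C}^*)^n$; here each $\chi_i:(\mathbb{C}^*)^n\to\mathbb{C}^*$ is a smooth (not necessarily algebraic) homomorphism. Let $\underline{\mathbb{R}}^{2\ell}=X\times\mathbb{R}^{2\ell}$ be the product bundle, and let $g\in(\mathbb{C}^*)^n$ act on $TX\oplus\underline{\mathbb{R}}^{2\ell}$ by its differential $g_*$ on $TX$ and by $(x,e)\mapsto(g\cdot x,e)$ on $\underline{\mathbb{R}}^{2\ell}$. A $(\mathbb{C}^*)^n$-invariant stably complex structure is a smooth real vector bundle endomorphism $J$ of $TX\oplus\underline{\mathbb{R}}^{2\ell}$ with $J^2=-1$ that commutes with this action. **Theorem.** Let $X$ be a topological toric manifold of dimension $2n$ and let $J$ be a $(\mathbb{C}^*)^n$-invariant stably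 complex structure on $TX\oplus\underline{\mathbb{R}}^{2\ell}$. Then $TX$ is a complex subbundle of $TX\oplus\underline{\mathbb{R}}^{2\ell}$, that is, $J(T_xX\oplus 0)\subseteq T_xX\oplus 0$ for every $x\in X$, and the restriction of $J$ to $TX$ is a $(\mathbb{C}^*)^n$-invariant almost complex structure on $X$: a smooth endomorphism $K$ of $TX$ with $K^2=-1$ and $K\circ g_*=g_*\circ K$ for all $g\in(\mathbb{C}^*)^n$. -/

import Mathlib

open scoped Manifold ContDiff Bundle
open Bundle

noncomputable section

/-- The group `(ℂ^*)^n`, as the group of units of the product ring `ℂ^n`; by Mathlib's instance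
for units of a complete normed algebra it is a real Lie group, open in `ℂ^n`.
The `j`-th component of `g` is `(g : Fin n → ℂ) j`. -/
abbrev ComplexTorus (n : ℕ) : Type := (Fin n → ℂ)ˣ

section Manifold

variable (n : ℕ) (X : Type*) [TopologicalSpace X] [ChartedSpace (EuclideanSpace ℝ (Fin (2 * n))) X]
  [MulAction (ComplexTorus n) X]

/-- An equivariant chart: a `C^∞` diffeomorphism `φ` of a `(ℂ^*)^n`-invariant open subset (the
source of `φ`) of `X` onto the whole of a direct sum `V(χ₁) ⊕ ⋯ ⊕ V(χₙ)` of complex one-dimensional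
smooth representation spaces of `(ℂ^*)^n`, intertwining the actions. Smoothness is in the real
sense; the characters `χ i : (ℂ^*)^n → ℂ^*` are not assumed to be algebraic or holomorphic. -/
structure EquivariantChart where
  φ : OpenPartialHomeomorph X (Fin n → ℂ)
  target_eq : φ.target = Set.univ
  smooth : ContMDiffOn (𝓡 (2 * n)) 𝓘(ℝ, Fin n → ℂ) ∞ φ φ.source
  smooth_symm : ContMDiff 𝓘(ℝ, Fin n → ℂ) (𝓡 (2 * n)) ∞ φ.symm
  χ : Fin n → ComplexTorus n →* ℂˣ
  smooth_χ : ∀ i, ContMDiff 𝓘(ℝ, Fin n → ℂ) 𝓘(ℝ, ℂ) ∞ (χ i)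
  invariant : ∀ (g : ComplexTorus n), ∀ x ∈ φ.source, g • x ∈ φ.source
  equivariant : ∀ (g : ComplexTorus n), ∀ x ∈ φ.source, ∀ i, φ (g • x) i = (χ i g : ℂ) * φ x i

/-- A topological toric manifold of dimension `2n`: a closed (compact, Hausdorff, without boundary)
smooth manifold with an effective smooth action of `(ℂ^*)^n` having an open dense orbit, which is
covered by equivariant charts. -/
structure IsTopologicalToricManifold : Prop where
  compact : CompactSpace X
  hausdorff : T2Space X
  smooth : IsManifold (𝓡 (2 * n)) ∞ X
  smooth_action : ContMDiff (𝓘(ℝ, Fin n → ℂ).prod (𝓡 (2 * n))) (𝓡 (2 * n)) ∞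
    (fun p : ComplexTorus n × X ↦ p.1 • p.2)
  effective : FaithfulSMul (ComplexTorus n) X
  open_dense_orbit : ∃ x : X,
    IsOpen (MulAction.orbit (ComplexTorus n) x) ∧ Dense (MulAction.orbit (ComplexTorus n) x)
  locally_representation : ∀ x : X, ∃ c : EquivariantChart n X, x ∈ c.φ.source

end Manifold

section Structures

variable {n : ℕ} {X : Type*} [TopologicalSpace X]
  [ChartedSpace (EuclideanSpace ℝ (Fin (2 * n))) X] [MulAction (ComplexTorus n) X]

/-- The differential at `x` of the action of `g`, as a map `T_x X → T_{g • x} X`. -/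
def actionDifferential (g : ComplexTorus n) (x : X) :
    TangentSpace (𝓡 (2 * n)) x →L[ℝ] TangentSpace (𝓡 (2 * n)) (g • x) :=
  mfderiv (𝓡 (2 * n)) (𝓡 (2 * n)) (fun y : X ↦ g • y) x

/-- The Whitney sum `TX ⊕ ℝ^k` of the tangent bundle and the product bundle of rank `k`. -/
abbrev StableTangent (n : ℕ) (X : Type*) [TopologicalSpace X]
    [ChartedSpace (EuclideanSpace ℝ (Fin (2 * n))) X] (k : ℕ) : X → Type :=
  (fun x : X ↦ TangentSpace (𝓡 (2 * n)) x) ×ᵇ Bundle.Trivial X (EuclideanSpace ℝ (Fin k))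

/-- `J` is a `(ℂ^*)^n`-invariant smooth complex structure on the real vector bundle `TX ⊕ ℝ^k`:
a smooth section of the bundle of real endomorphisms of `TX ⊕ ℝ^k` with `J ∘ J = -1` that commutes
with the action of `(ℂ^*)^n` on `TX ⊕ ℝ^k`, by the differential on `TX` and by the identity on the
fibre `ℝ^k` of the product bundle. -/
structure IsInvariantStablyComplex [IsManifold (𝓡 (2 * n)) ∞ X] {k : ℕ}
    (J : ∀ x : X, StableTangent n X k x →L[ℝ] StableTangent n X k x) : Prop where
  smooth : ContMDiff (𝓡 (2 * n))
    ((𝓡 (2 * n)).prod 𝓘(ℝ,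
      (EuclideanSpace ℝ (Fin (2 * n)) × EuclideanSpace ℝ (Fin k)) →L[ℝ]
      (EuclideanSpace ℝ (Fin (2 * n)) × EuclideanSpace ℝ (Fin k)))) ∞
    (fun x ↦ TotalSpace.mk'
      ((EuclideanSpace ℝ (Fin (2 * n)) × EuclideanSpace ℝ (Fin k)) →L[ℝ]
        (EuclideanSpace ℝ (Fin (2 * n)) × EuclideanSpace ℝ (Fin k)))
      (E := fun x ↦ StableTangent n X k x →L[ℝ] StableTangent n X k x) x (J x))
  sq_eq_neg : ∀ (x : X) (u : StableTangent n X k x), J x (J x u) = -u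
  invariant : ∀ (g : ComplexTorus n) (x : X) (v : TangentSpace (𝓡 (2 * n)) x)
    (e : EuclideanSpace ℝ (Fin k)),
    J (g • x) (actionDifferential g x v, e) =
      (actionDifferential g x (J x (v, e)).1, (J x (v, e)).2)

/-- `K` is a `(ℂ^*)^n`-invariant almost complex structure on `X`: a smooth section of the bundle of
real endomorphisms of `TX` with `K ∘ K = -1` that commutes with the differentials of the action. -/
structure IsInvariantAlmostComplex [IsManifold (𝓡 (2 * n)) ∞ X]
    (K : ∀ x : X, TangentSpace (𝓡 (2 * n)) x →L[ℝ] TangentSpace (𝓡 (2 * n)) x) : Prop where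
  smooth : ContMDiff (𝓡 (2 * n))
    ((𝓡 (2 * n)).prod 𝓘(ℝ,
      EuclideanSpace ℝ (Fin (2 * n)) →L[ℝ] EuclideanSpace ℝ (Fin (2 * n)))) ∞
    (fun x ↦ TotalSpace.mk'
      (EuclideanSpace ℝ (Fin (2 * n)) →L[ℝ] EuclideanSpace ℝ (Fin (2 * n)))
      (E := fun x : X ↦ TangentSpace (𝓡 (2 * n)) x →L[ℝ] TangentSpace (𝓡 (2 * n)) x) x (K x))
  sq_eq_neg : ∀ (x : X) (v : TangentSpace (𝓡 (2 * n)) x), K x (K x v) = -v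
  invariant : ∀ (g : ComplexTorus n) (x : X) (v : TangentSpace (𝓡 (2 * n)) x),
    K (g • x) (actionDifferential g x v) = actionDifferential g x (K x v)

end Structures

end

/-!
Write `C x v` for the `ℝ^k`-component of `J x (v, 0)`. Invariance of `J`, together with the triviality
of the action on the fibre `ℝ^k`, says `C (g • x) (g_* v) = C x v`. Read in an equivariant chart onto
`V(χ₁) ⊕ ⋯ ⊕ V(χₙ)`, this becomes `C (χ(g) w) (χ(g) u) = C w u`, where `χ(g)` acts coordinatewise.
An orbit dense in `X` is dense in the chart, so it accumulates at the origin and none of its points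
there has a vanishing coordinate. Hence `χᵢ(g) → 0` for all `i` simultaneously along some filter on
the torus (`EquivariantChart.exists_filter_tendsto_zero`). Along this filter `(χ(g) w, χ(g) u)`
tends to `(0, 0)`, so continuity of `C` gives `C w u = C 0 0 = 0`. The charts cover `X`, hence
`C = 0` (`snd_stablyComplex_eq_zero`).

Consequently `K x v = (J x (v, 0)).1` satisfies `J x (v, 0) = (K x v, 0)`, and it inherits invariance
and `K ∘ K = -1` from `J`. Its smoothness is a general fact on endomorphisms of Whitney sums
(`contMDiff_fst_comp_comp_inl`).
-/

open Filter Topology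

section BundleLemmas

variable {𝕜 B F₁ F₂ : Type*} [NontriviallyNormedField 𝕜]
  [NormedAddCommGroup F₁] [NormedSpace 𝕜 F₁] [NormedAddCommGroup F₂] [NormedSpace 𝕜 F₂]
  {E₁ E₂ : B → Type*}
  [∀ x, AddCommGroup (E₁ x)] [∀ x, Module 𝕜 (E₁ x)] [TopologicalSpace (TotalSpace F₁ E₁)]
  [∀ x, TopologicalSpace (E₁ x)] [∀ x, IsTopologicalAddGroup (E₁ x)]
  [∀ x, ContinuousSMul 𝕜 (E₁ x)]
  [∀ x, AddCommGroup (E₂ x)] [∀ x, Module 𝕜 (E₂ x)] [TopologicalSpace (TotalSpace F₂ E₂)]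
  [∀ x, TopologicalSpace (E₂ x)] [∀ x, IsTopologicalAddGroup (E₂ x)]
  [∀ x, ContinuousSMul 𝕜 (E₂ x)]
  {EB HB : Type*} [NormedAddCommGroup EB] [NormedSpace 𝕜 EB] [TopologicalSpace HB]
  {IB : ModelWithCorners 𝕜 EB HB} [TopologicalSpace B] [ChartedSpace HB B]
  [FiberBundle F₁ E₁] [VectorBundle 𝕜 F₁ E₁] [FiberBundle F₂ E₂] [VectorBundle 𝕜 F₂ E₂]

/-- A `C^m` endomorphism of a Whitney sum `E₁ ⊕ E₂` has a `C^m` diagonal block on `E₁`. -/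
theorem contMDiff_fst_comp_comp_inl {m : WithTop ℕ∞}
    {J : ∀ x : B, (E₁ ×ᵇ E₂) x →L[𝕜] (E₁ ×ᵇ E₂) x}
    (hJ : ContMDiff IB (IB.prod 𝓘(𝕜, (F₁ × F₂) →L[𝕜] (F₁ × F₂))) m
      (fun x ↦ TotalSpace.mk' ((F₁ × F₂) →L[𝕜] (F₁ × F₂))
        (E := fun x ↦ (E₁ ×ᵇ E₂) x →L[𝕜] (E₁ ×ᵇ E₂) x) x (J x))) :
    ContMDiff IB (IB.prod 𝓘(𝕜, F₁ →L[𝕜] F₁)) m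
      (fun x ↦ TotalSpace.mk' (F₁ →L[𝕜] F₁) (E := fun x ↦ E₁ x →L[𝕜] E₁ x) x
        ((ContinuousLinearMap.fst 𝕜 (E₁ x) (E₂ x)).comp
          ((J x).comp (ContinuousLinearMap.inl 𝕜 (E₁ x) (E₂ x))))) := by
  intro x₀
  have h := (contMDiffAt_hom_bundle _).1 (hJ x₀)
  refine (contMDiffAt_hom_bundle _).2 ⟨h.1, ?_⟩
  have h2 := (contMDiffAt_const (c := ContinuousLinearMap.fst 𝕜 F₁ F₂)).clm_comp
    (h.2.clm_comp (contMDiffAt_const (c := ContinuousLinearMap.inl 𝕜 F₁ F₂)))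
  refine h2.congr_of_eventuallyEq ?_
  filter_upwards [(trivializationAt F₁ E₁ x₀).open_baseSet.mem_nhds
      (mem_baseSet_trivializationAt F₁ E₁ x₀),
    (trivializationAt F₂ E₂ x₀).open_baseSet.mem_nhds
      (mem_baseSet_trivializationAt F₂ E₂ x₀)] with x h₁ h₂
  have hx : x ∈ (trivializationAt (F₁ × F₂) (E₁ ×ᵇ E₂) x₀).baseSet := ⟨h₁, h₂⟩
  ext v
  -- In the chosen trivializations, restricting to `E₁` and projecting onto it become the model
  -- maps `inl` and `fst`, since the trivialization of `E₁ ×ᵇ E₂` is the product one.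
  simp [ContinuousLinearMap.inCoordinates_eq hx hx, ContinuousLinearMap.inCoordinates_eq h₁ h₁]
  have hz : (trivializationAt F₂ E₂ x₀).symm x 0 = 0 :=
    ((trivializationAt F₂ E₂ x₀).symmL_apply (R := 𝕜) h₂ 0).symm.trans (map_zero _)
  rw [hz]

end BundleLemmas

/-- The characters of an equivariant chart can be made small simultaneously: the dense orbit
accumulates at the origin of the chart, and its points there have no zero coordinate. -/
theorem EquivariantChart.exists_filter_tendsto_zero {n : ℕ} {X : Type*} [TopologicalSpace X]
    [ChartedSpace (EuclideanSpace ℝ (Fin (2 * n))) X] [MulAction (ComplexTorus n) X]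
    (hX : ∃ x : X, Dense (MulAction.orbit (ComplexTorus n) x)) (c : EquivariantChart n X) :
    ∃ l : Filter (ComplexTorus n), l.NeBot ∧ ∀ i, Tendsto (fun g ↦ (c.χ i g : ℂ)) l (𝓝 0) := by
  obtain ⟨x, hx⟩ := hX
  have hs : c.φ.source.Nonempty :=
    ⟨c.φ.symm 0, c.φ.map_target (by rw [c.target_eq]; trivial)⟩
  obtain ⟨_, hys, g₀, rfl⟩ := hx.inter_open_nonempty _ c.φ.open_source hs
  set y : X := g₀ • x with hy
  have horb : Dense (Set.range fun g : ComplexTorus n ↦ c.φ (g • y)) := by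
    intro w
    have hw : w ∈ c.φ.target := by rw [c.target_eq]; trivial
    rw [mem_closure_iff]
    intro o ho hwo
    obtain ⟨_, ⟨hz1, hz2⟩, g, rfl⟩ := hx.inter_open_nonempty _ (c.φ.isOpen_inter_preimage ho)
      ⟨c.φ.symm w, c.φ.map_target hw, by simpa [c.φ.right_inv hw] using hwo⟩
    exact ⟨_, hz2, g * g₀⁻¹, by simp [hy, mul_smul]⟩
  -- Otherwise the orbit would lie in the hyperplane `w i = 0`.
  have hne (i : Fin n) : c.φ y i ≠ 0 := by
    intro h0
    obtain ⟨_, hz, g, rfl⟩ := horb.inter_open_nonempty {w | w i ≠ 0}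
      (isOpen_ne_fun (continuous_apply i) continuous_const) ⟨fun _ ↦ 1, by simp⟩
    exact hz (by simp [c.equivariant g y hys, h0])
  refine ⟨comap (fun g ↦ c.φ (g • y)) (𝓝 0), ?_, fun i ↦ ?_⟩
  · rw [comap_neBot_iff]
    intro t ht
    obtain ⟨_, hgt, g, rfl⟩ := mem_closure_iff_nhds.1 (horb 0) t ht
    exact ⟨g, hgt⟩
  · have h : Tendsto (fun g : ComplexTorus n ↦ c.φ (g • y) i / c.φ y i)
        (comap (fun g ↦ c.φ (g • y)) (𝓝 0)) (𝓝 (0 / c.φ y i)) :=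
      (((continuous_apply i).tendsto _).comp tendsto_comap).div_const _
    rw [zero_div] at h
    refine h.congr fun g ↦ ?_
    rw [c.equivariant g y hys, mul_div_cancel_right₀ _ (hne i)]

section Action
variable {n : ℕ} {X : Type*} [TopologicalSpace X]
  [ChartedSpace (EuclideanSpace ℝ (Fin (2 * n))) X] [MulAction (ComplexTorus n) X]

theorem EquivariantChart.smul_symm (c : EquivariantChart n X) (g : ComplexTorus n)
    (w : Fin n → ℂ) : g • c.φ.symm w = c.φ.symm ((fun i ↦ (c.χ i g : ℂ)) * w) := by
  have hw : w ∈ c.φ.target := by rw [c.target_eq]; trivial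
  have hs := c.φ.map_target hw
  rw [← c.φ.left_inv (c.invariant g _ hs)]
  congr 1
  ext i
  rw [c.equivariant g _ hs, c.φ.right_inv hw, Pi.mul_apply]

/-- The inverse of an equivariant chart intertwines the differential of the action with
coordinatewise multiplication by the characters. It is stated in the total space of `TX` because
the base points `g • φ⁻¹(w)` and `φ⁻¹(χ(g) w)` agree only propositionally. -/
theorem EquivariantChart.actionDifferential_tangentMap_symm [IsManifold (𝓡 (2 * n)) ∞ X]
    (hX : IsTopologicalToricManifold n X) (c : EquivariantChart n X) (g : ComplexTorus n)
    (w u : Fin n → ℂ) :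
    TotalSpace.mk' (EuclideanSpace ℝ (Fin (2 * n))) (E := TangentSpace (𝓡 (2 * n)))
        (g • c.φ.symm w) (actionDifferential g (c.φ.symm w)
          (mfderiv 𝓘(ℝ, Fin n → ℂ) (𝓡 (2 * n)) c.φ.symm w u)) =
      tangentMap 𝓘(ℝ, Fin n → ℂ) (𝓡 (2 * n)) c.φ.symm
        ⟨(fun i ↦ (c.χ i g : ℂ)) * w, (fun i ↦ (c.χ i g : ℂ)) * u⟩ := by
  have hg : MDifferentiable (𝓡 (2 * n)) (𝓡 (2 * n)) (fun y : X ↦ g • y) :=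
    (hX.smooth_action.comp (contMDiff_const.prodMk contMDiff_id)).mdifferentiable (by simp)
  have hφ : MDifferentiable 𝓘(ℝ, Fin n → ℂ) (𝓡 (2 * n)) c.φ.symm :=
    c.smooth_symm.mdifferentiable (by simp)
  let L : (Fin n → ℂ) →L[ℝ] (Fin n → ℂ) := ContinuousLinearMap.mul ℝ _ (fun i ↦ (c.χ i g : ℂ))
  have hL : MDifferentiable 𝓘(ℝ, Fin n → ℂ) 𝓘(ℝ, Fin n → ℂ) L :=
    L.contMDiff.mdifferentiable (n := 1) (by simp)
  have e : (fun y : X ↦ g • y) ∘ c.φ.symm = c.φ.symm ∘ L := by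
    ext w; exact c.smul_symm g w
  have h1 := tangentMap_comp_at (⟨w, u⟩ : TangentBundle 𝓘(ℝ, Fin n → ℂ) (Fin n → ℂ)) (hg _) (hφ w)
  rw [e, tangentMap_comp_at _ (hφ _) (hL _)] at h1
  refine Eq.trans h1.symm ?_
  congr 1
  simp only [tangentMap, L.mfderiv_eq]
  rfl

/-- The `ℝ^k`-component of `J` on `TX` vanishes. -/
theorem snd_stablyComplex_eq_zero [IsManifold (𝓡 (2 * n)) ∞ X]
    (hX : IsTopologicalToricManifold n X) {k : ℕ}
    {J : ∀ x : X, StableTangent n X k x →L[ℝ] StableTangent n X k x}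
    (hJ : IsInvariantStablyComplex J) (x : X) (v : TangentSpace (𝓡 (2 * n)) x) :
    (J x (v, 0)).2 = 0 := by
  let f : TangentBundle (𝓡 (2 * n)) X → EuclideanSpace ℝ (Fin k) := fun p ↦ (J p.1 (p.2, 0)).2
  have hf : Continuous f := by
    have h0 : Continuous (fun p : TangentBundle (𝓡 (2 * n)) X ↦
        TotalSpace.mk' (EuclideanSpace ℝ (Fin (2 * n)) × EuclideanSpace ℝ (Fin k))
          (E := StableTangent n X k) p.1 (p.2, 0)) := by
      rw [(FiberBundle.Prod.isInducing_diag _ _ _ _).continuous_iff]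
      refine Continuous.prodMk continuous_id ?_
      rw [(Trivial.isInducing_toProd _ _).continuous_iff]
      exact (FiberBundle.continuous_proj _ _).prodMk continuous_const
    have h1 := (hJ.smooth.continuous.comp (FiberBundle.continuous_proj
      (EuclideanSpace ℝ (Fin (2 * n))) (TangentSpace (𝓡 (2 * n)) (M := X)))).clm_bundle_apply
        (𝕜 := ℝ) h0
    have h2 := (FiberBundle.Prod.isInducing_diag _ _ _ _).continuous.comp h1
    have h3 := (Trivial.isInducing_toProd X (EuclideanSpace ℝ (Fin k))).continuous.comp
      (continuous_snd.comp h2)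
    exact (continuous_snd (X := X) (Y := EuclideanSpace ℝ (Fin k))).comp h3
  have hinv (g : ComplexTorus n) (p : TangentBundle (𝓡 (2 * n)) X) :
      f ⟨g • p.1, actionDifferential g p.1 p.2⟩ = f p := by
    change (J (g • p.1) (actionDifferential g p.1 p.2, 0)).2 = _
    rw [hJ.invariant g p.1 p.2 0]
  obtain ⟨c, hc⟩ := hX.locally_representation x
  obtain ⟨l, hl, hlim⟩ := c.exists_filter_tendsto_zero (hX.open_dense_orbit.imp fun _ h ↦ h.2)
  let F : (Fin n → ℂ) × (Fin n → ℂ) → EuclideanSpace ℝ (Fin k) := fun q ↦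
    f (tangentMap 𝓘(ℝ, Fin n → ℂ) (𝓡 (2 * n)) c.φ.symm ⟨q.1, q.2⟩)
  have hF : Continuous F := hf.comp ((c.smooth_symm.continuous_tangentMap (by simp)).comp
    (tangentBundleModelSpaceHomeomorph 𝓘(ℝ, Fin n → ℂ)).symm.continuous)
  -- The tangent vector is zero at the origin, as `F` is linear in its second argument.
  have hF0 : F 0 = 0 := by
    change (J _ (mfderiv 𝓘(ℝ, Fin n → ℂ) (𝓡 (2 * n)) c.φ.symm 0 0, 0)).2 = 0
    rw [map_zero]
    exact congrArg Prod.snd (map_zero (J (c.φ.symm 0)))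
  have key (q : (Fin n → ℂ) × (Fin n → ℂ)) : F q = 0 := by
    have ht (w : Fin n → ℂ) : Tendsto (fun g ↦ (fun i ↦ (c.χ i g : ℂ)) * w) l (𝓝 0) := by
      rw [tendsto_pi_nhds]
      intro i
      simpa using (hlim i).mul_const (w i)
    have h1 : Tendsto (fun g ↦ F ((fun i ↦ (c.χ i g : ℂ)) * q.1, (fun i ↦ (c.χ i g : ℂ)) * q.2)) l
        (𝓝 (F 0)) := (hF.tendsto 0).comp ((ht q.1).prodMk_nhds (ht q.2))
    have h2 (g : ComplexTorus n) :
        F ((fun i ↦ (c.χ i g : ℂ)) * q.1, (fun i ↦ (c.χ i g : ℂ)) * q.2) = F q := by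
      change f _ = f _
      rw [← c.actionDifferential_tangentMap_symm hX]
      exact hinv g (tangentMap 𝓘(ℝ, Fin n → ℂ) (𝓡 (2 * n)) c.φ.symm ⟨q.1, q.2⟩)
    simp only [h2, hF0] at h1
    exact tendsto_nhds_unique tendsto_const_nhds h1
  have hφ : c.φ.MDifferentiable (𝓡 (2 * n)) 𝓘(ℝ, Fin n → ℂ) :=
    ⟨c.smooth.mdifferentiableOn (by simp), (c.smooth_symm.mdifferentiable (by simp)).mdifferentiableOn⟩
  obtain ⟨w, rfl⟩ : ∃ w, c.φ.symm w = x := ⟨_, c.φ.left_inv hc⟩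
  obtain ⟨u, rfl⟩ := hφ.symm.mfderiv_surjective (x := w) (by simp [c.target_eq]) v
  exact key (w, u)

end Action

/-- For a `(ℂ^*)^n`-invariant complex structure `J` on `TX ⊕ ℝ^{2ℓ}` over a topological toric manifold
`X`, the subbundle `TX` is stable under `J`, and `J` restricts on it to an invariant almost complex
structure of `X`. -/
theorem theorem1p1 (n ℓ : ℕ) (X : Type*) [TopologicalSpace X]
    [ChartedSpace (EuclideanSpace ℝ (Fin (2 * n))) X] [IsManifold (𝓡 (2 * n)) ∞ X]
    [MulAction (ComplexTorus n) X] (hX : IsTopologicalToricManifold n X)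
    (J : ∀ x : X, StableTangent n X (2 * ℓ) x →L[ℝ] StableTangent n X (2 * ℓ) x)
    (hJ : IsInvariantStablyComplex J) :
    (∀ (x : X) (v : TangentSpace (𝓡 (2 * n)) x), (J x (v, 0)).2 = 0) ∧
    ∃ K : ∀ x : X, TangentSpace (𝓡 (2 * n)) x →L[ℝ] TangentSpace (𝓡 (2 * n)) x,
      IsInvariantAlmostComplex K ∧
      ∀ (x : X) (v : TangentSpace (𝓡 (2 * n)) x), J x (v, 0) = (K x v, 0) := by
  have h0 := snd_stablyComplex_eq_zero hX hJ
  refine ⟨h0, fun x ↦ (ContinuousLinearMap.fst ℝ _ _).comp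
    ((J x).comp (ContinuousLinearMap.inl ℝ _ _)), ?_, fun x v ↦ Prod.ext rfl (h0 x v)⟩
  refine ⟨contMDiff_fst_comp_comp_inl hJ.smooth, fun x v ↦ ?_, fun g x v ↦ ?_⟩
  · change (J x ((J x (v, 0)).1, 0)).1 = -v
    have h : J x (v, 0) = ((J x (v, 0)).1, 0) := Prod.ext rfl (h0 x v)
    rw [← h]
    exact congrArg Prod.fst (hJ.sq_eq_neg x (v, 0))
  · exact congrArg Prod.fst (hJ.invariant g x v 0)
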